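/- Call a finite set $Y\subset\mathbb{R}^3$ generic if no two distinct points of $Y$ share a coordinate. For $p,q\in\mathbb{R}^3$ let $B[p,q]=\{s\in\mathbb{R}^3 : \min(p_i,q_i)\le s_i\le\max(p_i,q_i),\ i=1,2,3\}$ be the axis-aligned box spanned by $p$ and $q$. The box graph $G_b(Y)$ has vertex set $Y$, and two distinct points $p,q\in Y$ are adjacent if and only if the open interior of $B[p,q]$ contains no point of $Y$. Theorem. For $n\ge 0$ let $b(n)$ be the maximum number of edges of $G_b(Y)$ over all generic sets $Y\subset\mathbb{R}^3$ of $n$ points (this maximum exists). Then $$b(n)=\tfrac{7}{16}n^2+o(n^2)\qquad(n\to\infty).$$ Equivalently, $b(n)=e(T(n,8))+o(n^2)$, where $e(T(n,8))$ is the number of edges of the Turán graph $T(n,8)$, i.e. of the complete $8$-partite graph on $n$ vertices whose parts differ in size by at most one. In particular box graphs of generic sets of $n$ points have at most $\tfrac{7}{16}n^2+o(n^2)$ edges, and up to the error term this bound is best possible. -/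

import Mathlib

open Asymptotics Filter

/-- The smallest axis-aligned box in `ℝ³` containing the two points `p` and `q`. -/
def spannedBox (p q : Fin 3 → ℝ) : Set (Fin 3 → ℝ) :=
  {s | ∀ i, min (p i) (q i) ≤ s i ∧ s i ≤ max (p i) (q i)}

/-- A set of points is generic if no two distinct points of it share a coordinate. -/
def IsGeneric (Y : Finset (Fin 3 → ℝ)) : Prop :=
  ∀ p ∈ Y, ∀ q ∈ Y, p ≠ q → ∀ i, p i ≠ q i

/-- A box (or any region) `B` is empty with respect to `Y` if its open interior contains no point
of `Y`; its boundary may contain points of `Y`. -/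
def IsEmptyFor (Y : Finset (Fin 3 → ℝ)) (B : Set (Fin 3 → ℝ)) : Prop :=
  ∀ z ∈ Y, z ∉ interior B

/-- The box graph of `Y`: its vertices are the points of `Y`, and two distinct points are adjacent
if and only if the box that they span is empty. -/
def boxGraph (Y : Finset (Fin 3 → ℝ)) : SimpleGraph Y where
  Adj p q := p ≠ q ∧ IsEmptyFor Y (spannedBox p q)
  symm := ⟨by
    rintro p q ⟨hne, h⟩
    refine ⟨hne.symm, ?_⟩
    have hB : spannedBox (q : Fin 3 → ℝ) p = spannedBox p q := by
      ext s
      simp only [spannedBox, Set.mem_ofPred_eq, min_comm, max_comm]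
    rw [hB]
    exact h⟩
  loopless := ⟨fun _ h => h.1 rfl⟩

/-- The numbers of edges that occur among the box graphs of generic sets of `n` points. -/
def boxEdgeCounts (n : ℕ) : Set ℕ :=
  {e | ∃ Y : Finset (Fin 3 → ℝ), Y.card = n ∧ IsGeneric Y ∧ (boxGraph Y).edgeSet.ncard = e}

/-!
The maximal number of edges is squeezed between the size of the Turán graph `T(n, 8)` and the
extremal number of the complete equipartite graph `K₉(17)` with nine parts of size seventeen.

*Upper bound.* Two points of a generic set differ by a vector whose signs, up to a global sign, form
one of four sign classes. If `p`, `m`, `r` increase in the first coordinate and the pairs `p, m` and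
`m, r` have the same class, then `m` is interior to the box of `p` and `r`. Suppose that the box
graph contains `K₉(17)`. Seventeen points always contain such a chain `p, m, r`
(`exists_signClass_chain`), so each of the nine parts has a middle point `mᵢ` of a chain of some
class `τᵢ`. All boxes between different parts are empty, so the pair `mᵢ, mⱼ` is in neither class
`τᵢ` nor `τⱼ`, and the nine middle points contain no chain of a single class. Recording for each
`mᵢ` the classes in which it is the lower point of a pair, with the entry at `τᵢ` left free, gives
nine pairwise disjoint two-element subsets of the sixteen sets of classes, which is impossible
(`not_avoiding_signClass`, `boxGraph_free`). The edge version of the Erdős–Stone theorem bounds the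
number of edges of a graph without `K₉(17)` by `(7/16 + o(1)) n²`.

*Lower bound.* Place eight clusters so that the vector between any two centers has mixed signs and
no center lies in the box of two others, and let each cluster be a short chain increasing in all
coordinates. Then every pair of points in different clusters spans an empty box
(`clusterPoint_notMem_interior`), so the box graph contains `T(n, 8)`.
-/

/-! ### The edge version of the Erdős–Stone theorem -/

open Finset in
/-- The edge version of the Erdős–Stone theorem, obtained from the minimal degree version by
deleting vertices of minimal degree one after the other. -/
theorem eventually_extremalNumber_completeEquipartiteGraph_le {r : ℕ} (t : ℕ) {ε : ℝ}
    (hr : 1 ≤ r) (hε : 0 < ε) :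
    ∀ᶠ n : ℕ in atTop,
      (SimpleGraph.extremalNumber n (SimpleGraph.completeEquipartiteGraph (r + 1) t) : ℝ) ≤
        ((1 - 1 / r) / 2 + ε) * (n : ℝ) ^ 2 := by
  classical
  set H := SimpleGraph.completeEquipartiteGraph (r + 1) t
  set d : ℝ := 1 - 1 / r + ε
  have hr' : (1 : ℝ) / r ≤ 1 := by
    rw [div_le_one (by positivity)]; exact_mod_cast hr
  have hd : 0 < d := by simp only [d]; linarith
  obtain ⟨N, hN⟩ := eventually_atTop.mp
    (SimpleGraph.eventually_completeEquipartiteGraph_isContained_of_minDegree hε r t)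
  have step : ∀ n ≥ N, (SimpleGraph.extremalNumber (n + 1) H : ℝ) ≤
      SimpleGraph.extremalNumber n H + d * (n + 1 : ℕ) := by
    intro n hn
    have key := SimpleGraph.extremalNumber_le_iff_of_nonneg (V := Fin (n + 1)) (R := ℝ) H
      (m := SimpleGraph.extremalNumber n H + d * (n + 1 : ℕ)) (by positivity)
    rw [Fintype.card_fin] at key
    refine key.2 fun G _ hG => ?_
    have hdeg : (G.minDegree : ℝ) < d * (n + 1 : ℕ) := by
      by_contra hcon
      exact hG (hN (n + 1) (by omega) (not_lt.mp hcon))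
    obtain ⟨v, hv⟩ := G.exists_minimal_degree_vertex
    have h1 := SimpleGraph.card_edgeFinset_deleteIncidenceSet_le_extremalNumber hG v
    have h2 := G.card_edgeFinset_deleteIncidenceSet v
    rw [Fintype.card_fin, Nat.add_sub_cancel] at h1
    have h3 : #G.edgeFinset ≤ SimpleGraph.extremalNumber n H + G.minDegree := by
      rw [hv]; omega
    have h3' : (#G.edgeFinset : ℝ) ≤ SimpleGraph.extremalNumber n H + G.minDegree := by
      exact_mod_cast h3
    linarith
  set C : ℝ := (SimpleGraph.extremalNumber N H : ℝ)
  have bound : ∀ n ≥ N, (SimpleGraph.extremalNumber n H : ℝ) ≤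
      C + d / 2 * (n : ℝ) ^ 2 + d / 2 * n := by
    intro n hn
    induction n, hn using Nat.le_induction with
    | base =>
      have : 0 ≤ d / 2 * (N : ℝ) ^ 2 + d / 2 * N := by positivity
      linarith
    | succ n hn ih =>
      have := step n hn
      push_cast at this ⊢
      nlinarith
  obtain ⟨M, hM⟩ := exists_nat_ge ((C + d / 2) / (ε / 2))
  filter_upwards [eventually_ge_atTop N, eventually_ge_atTop M, eventually_ge_atTop 1]
    with n h1 h2 h3
  have hb := bound n h1
  have h3' : (1 : ℝ) ≤ n := by exact_mod_cast h3
  have h2' : (M : ℝ) ≤ n := by exact_mod_cast h2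
  have hC : C + d / 2 ≤ ε / 2 * n := by
    rw [div_le_iff₀ (by positivity)] at hM
    nlinarith
  have hC0 : 0 ≤ C := by positivity
  -- the lower order terms are at most `(C + d / 2) * n`
  have : C + d / 2 * n ≤ ε / 2 * (n : ℝ) ^ 2 := by nlinarith
  have e : d / 2 = (1 - 1 / r) / 2 + ε / 2 := by simp only [d]; ring
  have e2 : d / 2 * (n : ℝ) ^ 2 = ((1 - 1 / r) / 2 + ε / 2) * (n : ℝ) ^ 2 := by rw [e]
  nlinarith

/-! ### Sign classes and boxes -/

theorem mem_interior_spannedBox {p q s : Fin 3 → ℝ} :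
    s ∈ interior (spannedBox p q) ↔ ∀ i, min (p i) (q i) < s i ∧ s i < max (p i) (q i) := by
  have : spannedBox p q = Set.pi Set.univ fun i => Set.Icc (min (p i) (q i)) (max (p i) (q i)) := by
    ext s; simp only [spannedBox, Set.mem_ofPred_eq, Set.mem_univ_pi, Set.mem_Icc]
  rw [this, interior_pi_set Set.finite_univ]
  simp [Set.mem_pi, interior_Icc]

/-- The sign class of a pair of points: whether the second and the third coordinates change in the
same direction as the first one. For points without common coordinates this is the sign vector of
`q - p` up to a global sign. -/
noncomputable def signClass (p q : Fin 3 → ℝ) : Bool × Bool :=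
  (decide (p 0 < q 0 ↔ p 1 < q 1), decide (p 0 < q 0 ↔ p 2 < q 2))

theorem signClass_comm {p q : Fin 3 → ℝ} (h : ∀ i, p i ≠ q i) :
    signClass p q = signClass q p := by
  have key : ∀ i, q i < p i ↔ ¬ p i < q i := fun i =>
    ⟨fun h' => h'.not_gt, fun h' => lt_of_le_of_ne (not_lt.mp h') (h i).symm⟩
  simp only [signClass, key, not_iff_not]

theorem mem_interior_spannedBox_of_signClass_eq {p q r : Fin 3 → ℝ} (hpq : ∀ i, p i ≠ q i)
    (hqr : ∀ i, q i ≠ r i) (h₁ : p 0 < q 0) (h₂ : q 0 < r 0)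
    (h : signClass p q = signClass q r) : q ∈ interior (spannedBox p r) := by
  have aux : ∀ i, (p i < q i ↔ q i < r i) →
      min (p i) (r i) < q i ∧ q i < max (p i) (r i) := by
    intro i hi
    rcases lt_or_gt_of_ne (hpq i) with h' | h'
    · exact ⟨min_lt_of_left_lt h', lt_max_of_lt_right (hi.1 h')⟩
    · have : r i < q i := lt_of_le_of_ne (not_lt.mp fun h'' => h'.not_gt (hi.2 h'')) (hqr i).symm
      exact ⟨min_lt_of_right_lt this, lt_max_of_lt_left h'⟩
  simp only [signClass, h₁, h₂, true_iff, Prod.mk.injEq, decide_eq_decide] at h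
  rw [mem_interior_spannedBox]
  intro i
  fin_cases i
  · exact aux 0 (by simp [h₁, h₂])
  · exact aux 1 h.1
  · exact aux 2 h.2

/-! ### Chains of a single sign class -/

/-- The sign classes of the pairs formed by the `i`-th point and the points above it in the first
coordinate. -/
def upperClasses {ι : Type*} (x : ι → Fin 3 → ℝ) (i : ι) : Set (Bool × Bool) :=
  {k | ∃ j, x i 0 < x j 0 ∧ signClass (x i) (x j) = k}

/-- If no three of the points form a chain of a single sign class, then the class of a pair tells
apart the two sets of upper classes: it belongs to that of the lower point only. -/
theorem signClass_mem_upperClasses_iff {ι : Type*} {x : ι → Fin 3 → ℝ}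
    (hgen : ∀ i j, i ≠ j → ∀ c, x i c ≠ x j c)
    (hchain : ∀ i j k, x i 0 < x j 0 → x j 0 < x k 0 →
      signClass (x i) (x j) ≠ signClass (x j) (x k)) {i j : ι} (hij : i ≠ j) :
    signClass (x i) (x j) ∈ upperClasses x i ↔ signClass (x i) (x j) ∉ upperClasses x j := by
  rcases lt_or_gt_of_ne (hgen i j hij 0) with h | h
  · refine iff_of_true ⟨j, h, rfl⟩ ?_
    rintro ⟨k, hk, e⟩
    exact hchain i j k h hk e.symm
  · rw [signClass_comm (hgen i j hij)]
    refine iff_of_false ?_ (not_not.mpr ⟨i, h, rfl⟩)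
    rintro ⟨k, hk, e⟩
    exact hchain j i k h hk e.symm

/-- Seventeen points contain a chain of a single sign class: otherwise the sets of upper classes
would be seventeen distinct sets of sign classes, but there are only `2 ^ 4` of those. -/
theorem exists_signClass_chain (x : Fin 17 → Fin 3 → ℝ)
    (hgen : ∀ i j, i ≠ j → ∀ c, x i c ≠ x j c) :
    ∃ i j k, x i 0 < x j 0 ∧ x j 0 < x k 0 ∧
      signClass (x i) (x j) = signClass (x j) (x k) := by
  classical
  by_contra! hchain
  have hinj : Function.Injective (upperClasses x) := by
    intro i j e
    by_contra hij
    have := signClass_mem_upperClasses_iff hgen hchain hij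
    rw [e] at this
    exact iff_not_self this
  have := Fintype.card_le_of_injective _ hinj
  simp at this

/-- At most eight points can be equipped with sign classes `τ i` that are avoided by all pairs
containing the `i`-th point if no three points form a chain of a single class. Changing the set of
upper classes of the `i`-th point at `τ i` gives two sets of sign classes for each point, and all
of these are distinct; so nine points would require `18 ≤ 2 ^ 4`. -/
theorem not_avoiding_signClass {x : Fin 9 → Fin 3 → ℝ} {τ : Fin 9 → Bool × Bool}
    (hgen : ∀ i j, i ≠ j → ∀ c, x i c ≠ x j c)
    (hchain : ∀ i j k, x i 0 < x j 0 → x j 0 < x k 0 →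
      signClass (x i) (x j) ≠ signClass (x j) (x k)) :
    ¬ ∀ i j, i ≠ j → signClass (x i) (x j) ≠ τ i := by
  classical
  intro hτ
  let F : Fin 9 × Bool → Set (Bool × Bool) := fun a =>
    {k | (k = τ a.1 ∧ a.2 = true) ∨ (k ≠ τ a.1 ∧ k ∈ upperClasses x a.1)}
  have hinj : Function.Injective F := by
    rintro ⟨i, a⟩ ⟨j, b⟩ e
    by_cases hij : i = j
    · subst hij
      have := Set.ext_iff.mp e (τ i)
      simp only [F, Set.mem_ofPred_eq, true_and, ne_eq, not_true, false_and, or_false] at this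
      rw [Bool.eq_iff_iff.mpr this]
    · exfalso
      have h₁ := hτ i j hij
      have h₂ : signClass (x i) (x j) ≠ τ j := by
        rw [signClass_comm (hgen i j hij)]; exact hτ j i (Ne.symm hij)
      -- at the class of the pair neither set was changed, and the upper classes differ
      have := Set.ext_iff.mp e (signClass (x i) (x j))
      simp only [F, Set.mem_ofPred_eq, h₁, h₂, false_and, ne_eq, not_false_eq_true, true_and,
        false_or] at this
      rw [signClass_mem_upperClasses_iff hgen hchain hij] at this
      exact iff_not_self this.symm
  have := Fintype.card_le_of_injective _ hinj
  simp at this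

/-! ### A complete equipartite graph that is not a subgraph of a box graph -/

/-- If two points of a generic set are adjacent in the box graph, then no point of the set lies
between them in the sense of sign classes. -/
theorem signClass_ne_of_boxGraph_adj {Y : Finset (Fin 3 → ℝ)} (hY : IsGeneric Y) {p q r : Y}
    (hadj : (boxGraph Y).Adj p r) (h₁ : p.1 0 < q.1 0) (h₂ : q.1 0 < r.1 0) :
    signClass p.1 q.1 ≠ signClass q.1 r.1 := by
  intro h
  have hpq : p.1 ≠ q.1 := fun e => h₁.ne (congrFun e 0)
  have hqr : q.1 ≠ r.1 := fun e => h₂.ne (congrFun e 0)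
  exact hadj.2 q.1 q.2 (mem_interior_spannedBox_of_signClass_eq (hY _ p.2 _ q.2 hpq)
    (hY _ q.2 _ r.2 hqr) h₁ h₂ h)

/-- A box graph contains no complete equipartite graph with nine parts of size seventeen. Each part
has a chain of a single sign class `τ i`. Its middle point cannot be joined in class `τ i` to the
middle point of another part, as it would lie in the box spanned by that point and one of the ends
of its own chain. -/
theorem boxGraph_free {Y : Finset (Fin 3 → ℝ)} (hY : IsGeneric Y) :
    (SimpleGraph.completeEquipartiteGraph 9 17).Free (boxGraph Y) := by
  rintro ⟨f⟩
  have hgen : ∀ a b : Fin 9 × Fin 17, a ≠ b → ∀ c, (f a).1 c ≠ (f b).1 c := fun a b hab =>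
    hY _ (f a).2 _ (f b).2 fun e => hab (f.injective (Subtype.ext e))
  have hadj : ∀ i j s t, i ≠ j → (boxGraph Y).Adj (f (i, s)) (f (j, t)) := fun i j s t hij =>
    f.toHom.map_adj (SimpleGraph.completeEquipartiteGraph_adj.mpr hij)
  choose p m r hpm hmr hτ using fun i : Fin 9 =>
    exists_signClass_chain (fun s => (f (i, s)).1)
      fun s t hst => hgen _ _ fun e => hst (congrArg Prod.snd e)
  have hgen' : ∀ i j, i ≠ j → ∀ c, (f (i, m i)).1 c ≠ (f (j, m j)).1 c := fun i j hij =>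
    hgen _ _ fun e => hij (congrArg Prod.fst e)
  refine not_avoiding_signClass (x := fun i => (f (i, m i)).1)
    (τ := fun i => signClass (f (i, p i)).1 (f (i, m i)).1) hgen' ?_ ?_
  · intro i j k h₁ h₂
    refine signClass_ne_of_boxGraph_adj hY (hadj i k _ _ ?_) h₁ h₂
    rintro rfl
    exact lt_asymm h₁ h₂
  · intro i j hij e
    rcases lt_or_gt_of_ne (hgen' i j hij 0) with h | h
    · exact signClass_ne_of_boxGraph_adj hY (hadj i j (p i) (m j) hij) (hpm i) h e.symm
    · refine signClass_ne_of_boxGraph_adj hY (hadj j i (m j) (r i) hij.symm) h (hmr i) ?_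
      rw [signClass_comm (hgen' j i hij.symm), e]
      exact hτ i

/-! ### The clustered configuration -/

/-- Eight points of `ℤ³`, indexed by the residues modulo `8` and given by their coordinates. They
are the sums `∑ k, bₖ 3ᵏ vₖ` over the binary digits `bₖ` of the index, where
`v₀ = (-1, 1, 1)`, `v₁ = (1, -1, 1)`, `v₂ = (1, 1, -1)`. The signs of the difference of two of them
are those of `± vₖ` for the highest digit `k` in which the indices differ. -/
def clusterCenter (c : Fin 3) (a : Fin 8) : ℤ :=
  ![![0, -1, 3, 2, 9, 8, 12, 11] a, ![0, 1, -3, -2, 9, 10, 6, 7] a,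
    ![0, 1, 3, 4, -9, -8, -6, -5] a] c

theorem clusterCenter_injective : ∀ c, Function.Injective (clusterCenter c) := by
  decide

theorem clusterCenter_not_monotone : ∀ a b, a ≠ b →
    (∃ c, clusterCenter c a < clusterCenter c b) ∧
      ∃ c, clusterCenter c b < clusterCenter c a := by
  decide

theorem clusterCenter_not_between : ∀ a b d, d ≠ a → d ≠ b → ∃ c,
    (clusterCenter c d < clusterCenter c a ∧ clusterCenter c d < clusterCenter c b) ∨
    (clusterCenter c a < clusterCenter c d ∧ clusterCenter c b < clusterCenter c d) := by
  decide

/-- A configuration of `n` points in eight clusters. The `i`-th point belongs to the cluster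
`i % 8`, and the points of a cluster increase in all coordinates. The centers are scaled by `n`
because the displacements `i` within the clusters are smaller than `n`. -/
def clusterPoint (n : ℕ) (i : Fin n) (c : Fin 3) : ℝ :=
  ((n * clusterCenter c (Fin.ofNat 8 i) + i : ℤ) : ℝ)

theorem clusterPoint_lt_of_clusterCenter_lt {n : ℕ} {i j : Fin n} {c : Fin 3}
    (h : clusterCenter c (Fin.ofNat 8 i) < clusterCenter c (Fin.ofNat 8 j)) :
    clusterPoint n i c < clusterPoint n j c := by
  unfold clusterPoint
  have := i.2
  have := j.2
  norm_cast
  nlinarith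

theorem clusterPoint_lt_iff {n : ℕ} {i j : Fin n} (c : Fin 3)
    (h : Fin.ofNat 8 i = Fin.ofNat 8 j) :
    clusterPoint n i c < clusterPoint n j c ↔ i < j := by
  unfold clusterPoint
  rw [h, Int.cast_lt, Fin.lt_def]
  omega

theorem clusterPoint_ne {n : ℕ} {i j : Fin n} (hij : i ≠ j) (c : Fin 3) :
    clusterPoint n i c ≠ clusterPoint n j c := by
  by_cases h : Fin.ofNat 8 (i : ℕ) = Fin.ofNat 8 j
  · rcases lt_or_gt_of_ne hij with h' | h'
    · exact ((clusterPoint_lt_iff c h).2 h').ne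
    · exact ((clusterPoint_lt_iff c h.symm).2 h').ne'
  · rcases lt_or_gt_of_ne ((clusterCenter_injective c).ne h) with h' | h'
    · exact (clusterPoint_lt_of_clusterCenter_lt h').ne
    · exact (clusterPoint_lt_of_clusterCenter_lt h').ne'

/-- The interior of a box spanned by points of two clusters contains no point of these two
clusters, since the points of a cluster increase in all coordinates while the diagonal of the box
does not. -/
theorem exists_clusterPoint_outside_of_same_cluster {n : ℕ} {i j l : Fin n}
    (hij : Fin.ofNat 8 (i : ℕ) ≠ Fin.ofNat 8 j) (hl : Fin.ofNat 8 (l : ℕ) = Fin.ofNat 8 i) :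
    ∃ c, (clusterPoint n l c ≤ clusterPoint n i c ∧ clusterPoint n l c < clusterPoint n j c) ∨
      (clusterPoint n i c ≤ clusterPoint n l c ∧ clusterPoint n j c < clusterPoint n l c) := by
  obtain ⟨⟨c, hc⟩, ⟨d, hd⟩⟩ := clusterCenter_not_monotone _ _ hij
  rcases le_or_gt l i with h | h
  · refine ⟨c, .inl ⟨?_, clusterPoint_lt_of_clusterCenter_lt (hl ▸ hc)⟩⟩
    exact not_lt.mp fun h' => h.not_gt ((clusterPoint_lt_iff c hl.symm).1 h')
  · exact ⟨d, .inr ⟨((clusterPoint_lt_iff d hl.symm).2 h).le,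
      clusterPoint_lt_of_clusterCenter_lt (hl ▸ hd)⟩⟩

theorem clusterPoint_notMem_interior {n : ℕ} {i j : Fin n}
    (hij : Fin.ofNat 8 (i : ℕ) ≠ Fin.ofNat 8 j) (l : Fin n) :
    clusterPoint n l ∉ interior (spannedBox (clusterPoint n i) (clusterPoint n j)) := by
  rw [mem_interior_spannedBox]
  intro H
  suffices ∃ c,
      (clusterPoint n l c ≤ clusterPoint n i c ∧ clusterPoint n l c ≤ clusterPoint n j c) ∨
      (clusterPoint n i c ≤ clusterPoint n l c ∧ clusterPoint n j c ≤ clusterPoint n l c) by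
    obtain ⟨c, ⟨h₁, h₂⟩ | ⟨h₁, h₂⟩⟩ := this
    · exact (H c).1.not_ge (le_min h₁ h₂)
    · exact (H c).2.not_ge (max_le h₁ h₂)
  by_cases hi : Fin.ofNat 8 (l : ℕ) = Fin.ofNat 8 i
  · obtain ⟨c, h⟩ := exists_clusterPoint_outside_of_same_cluster hij hi
    exact ⟨c, h.imp (fun h => ⟨h.1, h.2.le⟩) fun h => ⟨h.1, h.2.le⟩⟩
  by_cases hj : Fin.ofNat 8 (l : ℕ) = Fin.ofNat 8 j
  · obtain ⟨c, h⟩ := exists_clusterPoint_outside_of_same_cluster hij.symm hj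
    exact ⟨c, h.imp (fun h => ⟨h.2.le, h.1⟩) fun h => ⟨h.2.le, h.1⟩⟩
  obtain ⟨c, h⟩ := clusterCenter_not_between _ _ _ hi hj
  exact ⟨c, h.imp
    (fun h => ⟨(clusterPoint_lt_of_clusterCenter_lt h.1).le,
      (clusterPoint_lt_of_clusterCenter_lt h.2).le⟩)
    fun h => ⟨(clusterPoint_lt_of_clusterCenter_lt h.1).le,
      (clusterPoint_lt_of_clusterCenter_lt h.2).le⟩⟩

/-- The box graph of the clustered configuration contains the Turán graph with eight parts. -/
theorem exists_boxEdgeCounts_ge (n : ℕ) :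
    ∃ e ∈ boxEdgeCounts n, (SimpleGraph.turanGraph n 8).edgeSet.ncard ≤ e := by
  classical
  have hinj : Function.Injective (clusterPoint n) := fun i j e => by
    by_contra hij
    exact clusterPoint_ne hij 0 (congrFun e 0)
  let Y : Finset (Fin 3 → ℝ) := Finset.univ.map ⟨clusterPoint n, hinj⟩
  have hmem : ∀ i, clusterPoint n i ∈ Y := fun i => by simp [Y]
  have hY : ∀ z ∈ Y, ∃ i, clusterPoint n i = z := fun z hz => by simpa [Y] using hz
  refine ⟨_, ⟨Y, by simp [Y], ?_, rfl⟩, ?_⟩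
  · intro p hp q hq hpq
    obtain ⟨i, rfl⟩ := hY p hp
    obtain ⟨j, rfl⟩ := hY q hq
    exact clusterPoint_ne fun e => hpq (congrArg _ e)
  · let g : SimpleGraph.turanGraph n 8 →g boxGraph Y :=
      { toFun := fun i => ⟨clusterPoint n i, hmem i⟩
        map_rel' := by
          intro i j hij
          rw [SimpleGraph.turanGraph_adj] at hij
          refine ⟨fun e => hij ?_, fun z hz => ?_⟩
          · rw [hinj (Subtype.ext_iff.mp e)]
          · obtain ⟨l, rfl⟩ := hY z hz
            exact clusterPoint_notMem_interior (fun e => hij (congrArg Fin.val e)) l }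
    have hg : Function.Injective g := fun i j e => hinj (Subtype.ext_iff.mp e)
    refine Set.ncard_le_ncard_of_injOn (Sym2.map g) ?_ (Sym2.map.injective hg).injOn
      (Set.toFinite _)
    intro e he
    exact g.map_mem_edgeSet he

/-! ### The maximal number of edges -/

theorem boxEdgeCounts_le {n e : ℕ} (he : e ∈ boxEdgeCounts n) :
    e ≤ SimpleGraph.extremalNumber n (SimpleGraph.completeEquipartiteGraph 9 17) := by
  classical
  obtain ⟨Y, hn, hY, rfl⟩ := he
  have := SimpleGraph.card_edgeFinset_le_extremalNumber (boxGraph_free hY)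
  rwa [Fintype.card_coe, hn, ← Set.ncard_coe_finset, SimpleGraph.coe_edgeFinset] at this

theorem abs_ncard_edgeSet_turanGraph_eight_sub_le (n : ℕ) :
    |((SimpleGraph.turanGraph n 8).edgeSet.ncard : ℝ) - 7 / 16 * (n : ℝ) ^ 2| ≤ 23 := by
  have hcard : (SimpleGraph.turanGraph n 8).edgeSet.ncard =
      (SimpleGraph.turanGraph n 8).edgeFinset.card := by
    rw [← Set.ncard_coe_finset, SimpleGraph.coe_edgeFinset]
  rw [hcard]
  have hup := SimpleGraph.mul_card_edgeFinset_turanGraph_le (n := n) (r := 8)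
  have hlow : 7 * n ^ 2 ≤ 16 * (SimpleGraph.turanGraph n 8).edgeFinset.card + 368 := by
    rw [SimpleGraph.card_edgeFinset_turanGraph]
    have h1 : n % 8 ≤ 7 := by omega
    have h2 : (n % 8) ^ 2 ≤ 49 := Nat.pow_le_pow_left h1 2
    generalize (n % 8) ^ 2 = a at *
    generalize (n % 8).choose 2 = b at *
    generalize n ^ 2 = m at *
    omega
  have hup' : (2 * 8 * (SimpleGraph.turanGraph n 8).edgeFinset.card : ℝ) ≤ 7 * (n : ℝ) ^ 2 := by
    exact_mod_cast hup
  have hlow' : 7 * (n : ℝ) ^ 2 ≤ 16 * (SimpleGraph.turanGraph n 8).edgeFinset.card + 368 := by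
    exact_mod_cast hlow
  rw [abs_le]
  constructor <;> linarith

theorem ncard_edgeSet_turanGraph_eight_isLittleO :
    (fun n : ℕ => ((SimpleGraph.turanGraph n 8).edgeSet.ncard : ℝ) - 7 / 16 * (n : ℝ) ^ 2)
      =o[atTop] (fun n : ℕ => (n : ℝ) ^ 2) := by
  have hone : (fun n : ℕ => ((SimpleGraph.turanGraph n 8).edgeSet.ncard : ℝ) -
      7 / 16 * (n : ℝ) ^ 2) =O[atTop] (fun _ : ℕ => (1 : ℝ)) :=
    IsBigO.of_bound 23 (Eventually.of_forall fun n => by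
      simpa using abs_ncard_edgeSet_turanGraph_eight_sub_le n)
  refine hone.trans_isLittleO ?_
  rw [isLittleO_one_left_iff]
  exact tendsto_norm_atTop_atTop.comp
    ((tendsto_pow_atTop two_ne_zero).comp tendsto_natCast_atTop_atTop)

theorem mainTheorem3 :
    ∃ b : ℕ → ℕ, (∀ n : ℕ, IsGreatest (boxEdgeCounts n) (b n)) ∧
      (fun n : ℕ => (b n : ℝ) - 7 / 16 * (n : ℝ) ^ 2) =o[atTop] (fun n : ℕ => (n : ℝ) ^ 2) ∧
      (fun n : ℕ => (b n : ℝ) - ((SimpleGraph.turanGraph n 8).edgeSet.ncard : ℝ))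
        =o[atTop] (fun n : ℕ => (n : ℝ) ^ 2) := by
  have hbdd : ∀ n, BddAbove (boxEdgeCounts n) := fun n => ⟨_, fun _ he => boxEdgeCounts_le he⟩
  have hmax : ∀ n, IsGreatest (boxEdgeCounts n) (sSup (boxEdgeCounts n)) := fun n =>
    have ⟨e, he, _⟩ := exists_boxEdgeCounts_ge n
    ⟨Nat.sSup_mem ⟨e, he⟩ (hbdd n), fun _ he => le_csSup (hbdd n) he⟩
  have hmain : (fun n : ℕ => ((sSup (boxEdgeCounts n) : ℕ) : ℝ) - 7 / 16 * (n : ℝ) ^ 2)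
      =o[atTop] (fun n : ℕ => (n : ℝ) ^ 2) := by
    rw [isLittleO_iff]
    intro ε hε
    filter_upwards [eventually_extremalNumber_completeEquipartiteGraph_le (r := 8) 17
      (by norm_num) hε, isLittleO_iff.mp ncard_edgeSet_turanGraph_eight_isLittleO hε]
      with n hup hlow
    have h₁ : ((sSup (boxEdgeCounts n) : ℕ) : ℝ) ≤
        SimpleGraph.extremalNumber n (SimpleGraph.completeEquipartiteGraph 9 17) :=
      Nat.cast_le.mpr (boxEdgeCounts_le (hmax n).1)
    have h₂ : ((SimpleGraph.turanGraph n 8).edgeSet.ncard : ℝ) ≤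
        ((sSup (boxEdgeCounts n) : ℕ) : ℝ) := by
      obtain ⟨e, he, hle⟩ := exists_boxEdgeCounts_ge n
      exact Nat.cast_le.mpr (hle.trans ((hmax n).2 he))
    rw [Real.norm_eq_abs, Real.norm_of_nonneg (by positivity), abs_le] at hlow ⊢
    norm_num at hup
    constructor <;> linarith [hlow.1]
  exact ⟨_, hmax, hmain, by simpa using hmain.sub ncard_edgeSet_turanGraph_eight_isLittleO⟩
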